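/- Let $n,m,d\in\mathbb{N}$, let $f,g_1,\dots,g_m\in\mathbb{R}[x]=\mathbb{R}[x_1,\dots,x_n]$, $d_0:=\deg f$, $v_j:=\lceil(\deg g_j)/2\rceil$, and $K:=\{x\in\mathbb{R}^n: g_j(x)\ge 0,\ j=1,\dots,m\}$. (The degree of the zero polynomial is taken to be $0$.) For an integer $e$ put $\mathbb{N}^n_e:=\{\alpha\in\mathbb{N}^n:|\alpha|\le e\}$ (empty if $e<0$), let $v_e(x)=(x^\alpha)_{\alpha\in\mathbb{N}^n_e}$, $S:=\mathbb{N}^n_{d_0}\setminus\{0\}$, and define symmetric matrices $B_\alpha$ and $C^j_\alpha$ by $$v_d(x)v_d(x)^T=\sum_\alpha B_\alpha x^\alpha,\qquad g_j(x)\,v_{d-v_j}(x)v_{d-v_j}(x)^T=\sum_\alpha C^j_\alpha x^\alpha .$$ For a real sequence $z=(z_\alpha)_{\alpha\in\mathbb{N}^n}$, let $M_d(z)=(z_{\beta+\gamma})_{\beta,\gamma\in\mathbb{N}^n_d}$ be the moment matrix and $M_{d-v_j}(g_jz)=\big(\sum_\delta (g_j)_\delta z_{\beta+\gamma+\delta}\big)_{\beta,\gamma\in\mathbb{N}^n_{d-v_j}}$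 the localizing matrix. (A matrix with empty index set counts as positive semidefinite.) Write $\langle A,B\rangle$ for the trace inner product. Say that $(\tilde f,Z_0,\dots,Z_m)$ satisfies (C) if $\tilde f\in\mathbb{R}[x]$ has degree at most $d_0$, all $Z_j$ are real symmetric matrices of the appropriate sizes with $Z_j\succeq0$, and for every $\alpha\in\mathbb{N}^n$ $$\langle Z_0,B_\alpha\rangle+\sum_{j=1}^m\langle Z_j,C^j_\alpha\rangle=\begin{cases}\tilde f_\alpha,&0<|\alpha|\le d_0,\\ 0,&\alpha=0\text{ or }|\alpha|>d_0.\end{cases}$$ Say that $z$ satisfies (M) if $M_d(z)\succeq0$ and $M_{d-v_j}(g_jz)\succeq0$ for $j=1,\dots,m$. Consider the following three pairs of semidefinite programs. * $(\mathrm{P}_1)$: minimize $\sum_{\alpha\in S}\lambda_\alpha$ over $\lambda\in\mathbb{R}^S$ and $(\tilde f,Z_j)$ satisfying (C), subject to $\lambda_\alpha\ge0$, $\lambda_\alpha+\tilde f_\alpha\ge f_\alpha$, $\lambda_\alpha-\tilde f_\alpha\ge -f_\alpha$ for all $\alpha\in S$. $(\mathrm{D}_1)$: maximize $\sum_{\alpha\in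 S}f_\alpha(u_\alpha-v_\alpha)$ over $u,v\in\mathbb{R}^S$ and $z$ satisfying (M), subject to $u_\alpha,v_\alpha\ge0$, $u_\alpha+v_\alpha\le1$, $u_\alpha-v_\alpha+z_\alpha=0$ for all $\alpha\in S$. * $(\mathrm{P}_\infty)$: minimize $\lambda$ over $\lambda\in\mathbb{R}$ and $(\tilde f,Z_j)$ satisfying (C), subject to $\lambda\ge0$, $\lambda+\tilde f_\alpha\ge f_\alpha$, $\lambda-\tilde f_\alpha\ge -f_\alpha$ for all $\alpha\in S$. $(\mathrm{D}_\infty)$: maximize $\sum_{\alpha\in S}f_\alpha(u_\alpha-v_\alpha)$ over $u,v\in\mathbb{R}^S$ and $z$ satisfying (M), subject to $\sum_{\alpha\in S}(u_\alpha+v_\alpha)\le1$ and $u_\alpha,v_\alpha\ge0$, $u_\alpha-v_\alpha+z_\alpha=0$ for all $\alpha\in S$. * $(\mathrm{P}_2)$: minimize $\sum_{\alpha\in S}\lambda_\alpha$ over $\lambda\in\mathbb{R}^S$ and $(\tilde f,Z_j)$ satisfying (C), subject to $\lambda_\alpha\ge0$ and $\begin{pmatrix}\lambda_\alpha&\tilde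 f_\alpha-f_\alpha\\ \tilde f_\alpha-f_\alpha&1\end{pmatrix}\succeq0$ for all $\alpha\in S$. $(\mathrm{D}_2)$: maximize $\sum_{\alpha\in S}\Big\langle\Delta_\alpha,\begin{pmatrix}0&f_\alpha\\ f_\alpha&-1\end{pmatrix}\Big\rangle$ over real symmetric $2\times2$ matrices $\Delta_\alpha\succeq0$ ($\alpha\in S$) and $z$ satisfying (M), subject to $\Big\langle\Delta_\alpha,\begin{pmatrix}1&0\\0&0\end{pmatrix}\Big\rangle\le1$ and $\Big\langle\Delta_\alpha,\begin{pmatrix}0&1\\1&0\end{pmatrix}\Big\rangle+z_\alpha=0$ for all $\alpha\in S$. Assume that $K$ has nonempty interior. Then for each $k\in\{1,\infty,2\}$ there is no duality gap between $(\mathrm{P}_k)$ and $(\mathrm{D}_k)$: the infimum of $(\mathrm{P}_k)$ equals the supremum of $(\mathrm{D}_k)$. Moreover, each $(\mathrm{P}_k)$ has an optimal solution, whose component $\tilde f=:\tilde f_d$ is a polynomial of degree at most $d_0$. -/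

import Mathlib

noncomputable section

namespace InvPolyOpt

/-- The finite set of multi-indices `α ∈ ℕⁿ` with `|α| + v ≤ d`, i.e. `|α| ≤ d - v` where `d - v` is
the difference of integers; the set is empty when `d < v`. -/
def multiIdx (n d v : ℕ) : Finset (Fin n →₀ ℕ) :=
  ((Finset.range (d + 1)).biUnion fun k => Finset.finsuppAntidiag Finset.univ k).filter
    fun α => α.degree + v ≤ d

theorem mem_multiIdx {n d v : ℕ} {α : Fin n →₀ ℕ} :
    α ∈ multiIdx n d v ↔ α.degree + v ≤ d := by
  simp only [multiIdx, Finset.mem_filter, Finset.mem_biUnion, Finset.mem_range,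
    Finset.mem_finsuppAntidiag, and_iff_right_iff_imp]
  intro h
  refine ⟨α.degree, by omega, ?_, Finset.subset_univ _⟩
  rw [Finsupp.degree_eq_sum]

/-- The finite set `ℕⁿ_e \ {0}` of nonzero multi-indices `α` with `|α| ≤ e`. -/
def nzIdx (n e : ℕ) : Finset (Fin n →₀ ℕ) := (multiIdx n e 0).erase 0

/-- The basic semi-algebraic set `K = {x ∈ ℝⁿ : g_j(x) ≥ 0, j = 1, …, m}`. -/
def feasibleSet {n m : ℕ} (g : Fin m → MvPolynomial (Fin n) ℝ) : Set (Fin n → ℝ) :=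
  {x | ∀ j, 0 ≤ MvPolynomial.eval x (g j)}

/-- `⌈deg p / 2⌉`. -/
def halfDeg {n : ℕ} (p : MvPolynomial (Fin n) ℝ) : ℕ := (p.totalDegree + 1) / 2

/-- The inner product `⟨A, B⟩ = ∑ A_{ij} B_{ij}` (the trace of `A B` for symmetric matrices). -/
def matInner {ι : Type*} [Fintype ι] (A B : Matrix ι ι ℝ) : ℝ := ∑ i, ∑ j, A i j * B i j

/-- The matrix `B_α`: the coefficient of `x^α` in the polynomial matrix `v_d(x) v_d(x)ᵀ`, whose
`(β, γ)` entry is `x^β x^γ`. -/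
def momentCoeff (n d : ℕ) (α : Fin n →₀ ℕ) : Matrix (multiIdx n d 0) (multiIdx n d 0) ℝ :=
  fun β γ => MvPolynomial.coeff α
    (MvPolynomial.monomial β.1 (1 : ℝ) * MvPolynomial.monomial γ.1 (1 : ℝ))

/-- The matrix `C_α` of the polynomial `p`: the coefficient of `x^α` in the polynomial matrix
`p(x) v(x) v(x)ᵀ`, where `v` is the vector of monomials of degree at most `d - ⌈deg p / 2⌉`. -/
def localizingCoeff {n : ℕ} (d : ℕ) (p : MvPolynomial (Fin n) ℝ) (α : Fin n →₀ ℕ) :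
    Matrix (multiIdx n d (halfDeg p)) (multiIdx n d (halfDeg p)) ℝ :=
  fun β γ => MvPolynomial.coeff α
    (p * (MvPolynomial.monomial β.1 (1 : ℝ) * MvPolynomial.monomial γ.1 (1 : ℝ)))

/-- The moment matrix `M_d(z)`, with entries `z_{β+γ}`. -/
def momentMatrix {n : ℕ} (d : ℕ) (z : (Fin n →₀ ℕ) → ℝ) :
    Matrix (multiIdx n d 0) (multiIdx n d 0) ℝ :=
  fun β γ => z (β.1 + γ.1)

/-- The localizing matrix `M_{d-v}(p z)`, `v = ⌈deg p / 2⌉`, with entries `∑_δ p_δ z_{β+γ+δ}`. -/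
def localizingMatrix {n : ℕ} (d : ℕ) (p : MvPolynomial (Fin n) ℝ) (z : (Fin n →₀ ℕ) → ℝ) :
    Matrix (multiIdx n d (halfDeg p)) (multiIdx n d (halfDeg p)) ℝ :=
  fun β γ => ∑ δ ∈ p.support, p.coeff δ * z (β.1 + γ.1 + δ)

/-- The variables `f̃, Z_0, Z_1, …, Z_m` common to the three primal semidefinite programs. -/
structure CertVars {n m : ℕ} (g : Fin m → MvPolynomial (Fin n) ℝ) (d : ℕ) where
  ft : MvPolynomial (Fin n) ℝ
  Z0 : Matrix (multiIdx n d 0) (multiIdx n d 0) ℝ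
  Z : ∀ j : Fin m, Matrix (multiIdx n d (halfDeg (g j))) (multiIdx n d (halfDeg (g j))) ℝ

/-- The constraints common to the three primal semidefinite programs: `f̃ ∈ ℝ[x]_{d₀}`, all the
`Z_j` are (symmetric) positive semidefinite, and for every `α`,
`⟨Z_0, B_α⟩ + ∑_j ⟨Z_j, C^j_α⟩` is `f̃_α` if `0 < |α| ≤ d₀`, and `0` if `α = 0` or `|α| > d₀`. -/
def CertVars.Feasible {n m : ℕ} {g : Fin m → MvPolynomial (Fin n) ℝ} {d : ℕ} (d₀ : ℕ)
    (c : CertVars g d) : Prop :=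
  c.ft.totalDegree ≤ d₀ ∧ c.Z0.PosSemidef ∧ (∀ j, (c.Z j).PosSemidef) ∧
    ∀ α : Fin n →₀ ℕ,
      matInner c.Z0 (momentCoeff n d α) + ∑ j, matInner (c.Z j) (localizingCoeff d (g j) α)
        = if α = 0 ∨ d₀ < α.degree then 0 else c.ft.coeff α

/-- The constraints common to the three dual programs:
`M_d(z) ⪰ 0` and `M_{d-v_j}(g_j z) ⪰ 0`, `j = 1, …, m`. -/
def MomentFeasible {n m : ℕ} (g : Fin m → MvPolynomial (Fin n) ℝ) (d : ℕ)
    (z : (Fin n →₀ ℕ) → ℝ) : Prop :=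
  (momentMatrix d z).PosSemidef ∧ ∀ j, (localizingMatrix d (g j) z).PosSemidef

section Programs

variable {n m : ℕ}

/-! The case `k = 1`. -/

/-- Variables `((λ_α), (f̃, Z_j))` of the primal program for `k = 1`, and also for `k = 2`. -/
abbrev PrimalVars (f : MvPolynomial (Fin n) ℝ) (g : Fin m → MvPolynomial (Fin n) ℝ) (d : ℕ) :=
  (nzIdx n f.totalDegree → ℝ) × CertVars g d

/-- Objective `∑ λ_α` of the primal program for `k = 1`, and also for `k = 2`. -/
def primalObj (f : MvPolynomial (Fin n) ℝ) (g : Fin m → MvPolynomial (Fin n) ℝ) (d : ℕ)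
    (p : PrimalVars f g d) : ℝ := ∑ α, p.1 α

/-- Feasible set of the primal program for `k = 1`. -/
def primalFeasOne (f : MvPolynomial (Fin n) ℝ) (g : Fin m → MvPolynomial (Fin n) ℝ) (d : ℕ) :
    Set (PrimalVars f g d) :=
  {p | (∀ α, 0 ≤ p.1 α) ∧
    (∀ α, f.coeff α.1 ≤ p.1 α + p.2.ft.coeff α.1) ∧
    (∀ α, -f.coeff α.1 ≤ p.1 α - p.2.ft.coeff α.1) ∧
    p.2.Feasible f.totalDegree}

/-- Variables of the dual program for `k = 1` and for `k = ∞`: `u = (u_α)` and `v = (v_α)`, indexed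
by `0 < |α| ≤ d₀`, and a real sequence `z = (z_α)`. -/
structure DualVars (f : MvPolynomial (Fin n) ℝ) where
  u : nzIdx n f.totalDegree → ℝ
  v : nzIdx n f.totalDegree → ℝ
  z : (Fin n →₀ ℕ) → ℝ

/-- Objective `∑ f_α (u_α - v_α)` of the dual program for `k = 1` and for `k = ∞`. -/
def dualObj (f : MvPolynomial (Fin n) ℝ) (q : DualVars f) : ℝ :=
  ∑ α, f.coeff α.1 * (q.u α - q.v α)

/-- Feasible set of the dual program for `k = 1`. -/
def dualFeasOne (f : MvPolynomial (Fin n) ℝ) (g : Fin m → MvPolynomial (Fin n) ℝ) (d : ℕ) :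
    Set (DualVars f) :=
  {q | (∀ α, 0 ≤ q.u α) ∧ (∀ α, 0 ≤ q.v α) ∧
    (∀ α, q.u α + q.v α ≤ 1) ∧
    (∀ α, q.u α - q.v α + q.z α.1 = 0) ∧
    MomentFeasible g d q.z}

/-! The case `k = ∞`. -/

/-- Variables `(λ, (f̃, Z_j))` of the primal program for `k = ∞`. -/
abbrev PrimalVarsTop (g : Fin m → MvPolynomial (Fin n) ℝ) (d : ℕ) := ℝ × CertVars g d

/-- Objective `λ` of the primal program for `k = ∞`. -/
def primalObjTop (g : Fin m → MvPolynomial (Fin n) ℝ) (d : ℕ) (p : PrimalVarsTop g d) : ℝ := p.1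

/-- Feasible set of the primal program for `k = ∞`. -/
def primalFeasTop (f : MvPolynomial (Fin n) ℝ) (g : Fin m → MvPolynomial (Fin n) ℝ) (d : ℕ) :
    Set (PrimalVarsTop g d) :=
  {p | 0 ≤ p.1 ∧
    (∀ α : nzIdx n f.totalDegree, f.coeff α.1 ≤ p.1 + p.2.ft.coeff α.1) ∧
    (∀ α : nzIdx n f.totalDegree, -f.coeff α.1 ≤ p.1 - p.2.ft.coeff α.1) ∧
    p.2.Feasible f.totalDegree}

/-- Feasible set of the dual program for `k = ∞`. -/
def dualFeasTop (f : MvPolynomial (Fin n) ℝ) (g : Fin m → MvPolynomial (Fin n) ℝ) (d : ℕ) :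
    Set (DualVars f) :=
  {q | (∀ α, 0 ≤ q.u α) ∧ (∀ α, 0 ≤ q.v α) ∧
    (∑ α, (q.u α + q.v α)) ≤ 1 ∧
    (∀ α, q.u α - q.v α + q.z α.1 = 0) ∧
    MomentFeasible g d q.z}

/-! The case `k = 2`. -/

/-- Feasible set of the primal program for `k = 2`. -/
def primalFeasTwo (f : MvPolynomial (Fin n) ℝ) (g : Fin m → MvPolynomial (Fin n) ℝ) (d : ℕ) :
    Set (PrimalVars f g d) :=
  {p | (∀ α, 0 ≤ p.1 α) ∧
    (∀ α, (!![p.1 α, p.2.ft.coeff α.1 - f.coeff α.1;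
              p.2.ft.coeff α.1 - f.coeff α.1, 1] : Matrix (Fin 2) (Fin 2) ℝ).PosSemidef) ∧
    p.2.Feasible f.totalDegree}

/-- Variables of the dual program for `k = 2`: 2×2 matrices `Δ_α`, indexed by `0 < |α| ≤ d₀`, and a
real sequence `z = (z_α)`. -/
structure DualVarsTwo (f : MvPolynomial (Fin n) ℝ) where
  Δ : nzIdx n f.totalDegree → Matrix (Fin 2) (Fin 2) ℝ
  z : (Fin n →₀ ℕ) → ℝ

/-- Objective of the dual program for `k = 2`. -/
def dualObjTwo (f : MvPolynomial (Fin n) ℝ) (q : DualVarsTwo f) : ℝ :=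
  ∑ α, matInner (q.Δ α) !![0, f.coeff α.1; f.coeff α.1, -1]

/-- Feasible set of the dual program for `k = 2`. -/
def dualFeasTwo (f : MvPolynomial (Fin n) ℝ) (g : Fin m → MvPolynomial (Fin n) ℝ) (d : ℕ) :
    Set (DualVarsTwo f) :=
  {q | (∀ α, matInner (q.Δ α) !![1, 0; 0, 0] ≤ 1) ∧
    (∀ α, matInner (q.Δ α) !![0, 1; 1, 0] + q.z α.1 = 0) ∧
    MomentFeasible g d q.z ∧
    ∀ α, (q.Δ α).PosSemidef}

end Programs

/-- No duality gap between `min {φ p : p ∈ P}` and `max {ψ q : q ∈ D}`: the two optimal values,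
as extended real numbers, coincide. -/
def NoDualityGap {X Y : Type*} (P : Set X) (φ : X → ℝ) (D : Set Y) (ψ : Y → ℝ) : Prop :=
  (⨅ p ∈ P, ((φ p : ℝ) : EReal)) = ⨆ q ∈ D, ((ψ q : ℝ) : EReal)

/-- The program `min {φ p : p ∈ P}` has an optimal solution. -/
def HasOptimalSolution {X : Type*} (P : Set X) (φ : X → ℝ) : Prop :=
  ∃ p ∈ P, IsMinOn φ P p

end InvPolyOpt

end

/-! Let `F` be the vector of coefficients of `f` indexed by S. Eliminating the slack variables, each
primal program minimizes a convex function φ(a), namely the ℓ¹ distance, the sup distance or the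
squared ℓ² distance from `F` to `a`, over those `a` for which the polynomial ∑ a_α x^α, which has no
constant term, lies in the truncated quadratic module Q = {σ₀ + ∑ σ_j g_j}, with Gram matrices as in
(C).

The key point is that Q is a closed cone. It is the linear image of a product of positive
semidefinite cones. If such a certificate is the zero polynomial, each of its summands is
nonnegative on K, hence vanishes on the interior of K, hence is the zero polynomial; so every Gram
matrix attached to a nonzero `g j` is 0. A linear map that vanishes on a closed cone only at 0 has
closed image on it (`isClosed_image_of_closed_cone`, `isClosed_truncModule`). Since φ has compact
sublevel sets, the primal minimum is attained (`exists_isMinOn_truncModule`).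

Weak duality pairs a certificate with a moment sequence. For the converse, if c ≥ 0 is below every
primal value, the compact convex set {φ ≤ c} misses the closed cone. A strictly separating
functional is nonnegative on Q, so it is a sequence z satisfying (M), and it is negative on {φ ≤ c}
(`exists_momentFeasible_separating`). Evaluating it at the point of the ball where it is largest and
rescaling z gives a dual point of value at least c. No attainment in the dual is needed. -/

namespace InvPolyOpt

open MvPolynomial Matrix

/-! ### Gram matrices and the polynomials they represent -/

section Gram

variable {n : ℕ} {s : Finset (Fin n →₀ ℕ)}

/-- The polynomial `v(x)ᵀ Z v(x)`, where `v` is the vector of monomials with exponents in `s`. -/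
noncomputable def gramPoly (s : Finset (Fin n →₀ ℕ)) : Matrix s s ℝ →ₗ[ℝ] MvPolynomial (Fin n) ℝ where
  toFun Z := ∑ β, ∑ γ, Z β γ • (monomial β.1 (1 : ℝ) * monomial γ.1 (1 : ℝ))
  map_add' Z W := by simp only [Matrix.add_apply, add_smul, Finset.sum_add_distrib]
  map_smul' r Z := by
    simp only [Matrix.smul_apply, smul_assoc, Finset.smul_sum, RingHom.id_apply]

theorem gramPoly_apply (Z : Matrix s s ℝ) :
    gramPoly s Z = ∑ β, ∑ γ, Z β γ • (monomial β.1 (1 : ℝ) * monomial γ.1 (1 : ℝ)) := rfl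

theorem map_mul_gramPoly (ℓ : MvPolynomial (Fin n) ℝ →ₗ[ℝ] ℝ) (p : MvPolynomial (Fin n) ℝ)
    (Z : Matrix s s ℝ) :
    ℓ (p * gramPoly s Z) =
      matInner Z (fun β γ => ℓ (p * (monomial β.1 (1 : ℝ) * monomial γ.1 (1 : ℝ)))) := by
  simp only [gramPoly_apply, Finset.mul_sum, mul_smul_comm, map_sum, map_smul, matInner,
    smul_eq_mul]

/-- The vector of monomials with exponents in `s`, evaluated at `x`. -/
noncomputable def monomialVec (s : Finset (Fin n →₀ ℕ)) (x : Fin n → ℝ) : s → ℝ :=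
  fun β => eval x (monomial β.1 (1 : ℝ))

theorem eval_gramPoly (Z : Matrix s s ℝ) (x : Fin n → ℝ) :
    eval x (gramPoly s Z) = star (monomialVec s x) ⬝ᵥ (Z *ᵥ monomialVec s x) := by
  simp only [gramPoly_apply, map_sum, smul_eval, map_mul, dotProduct, mulVec, monomialVec,
    Finset.mul_sum, star_trivial]
  refine Finset.sum_congr rfl fun β _ => Finset.sum_congr rfl fun γ _ => by ring

theorem eval_gramPoly_nonneg {Z : Matrix s s ℝ} (hZ : Z.PosSemidef) (x : Fin n → ℝ) :
    0 ≤ eval x (gramPoly s Z) := by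
  rw [eval_gramPoly]
  exact hZ.dotProduct_mulVec_nonneg _

/-- Semidefiniteness is essential, since distinct Gram matrices can represent the same polynomial.
If v(x)ᵀ Z v(x) = 0 then Z v(x) = 0, so each row of Z gives a polynomial vanishing everywhere, and
its coefficients are the entries of that row. -/
theorem eq_zero_of_gramPoly_eq_zero {Z : Matrix s s ℝ} (hZ : Z.PosSemidef)
    (h : gramPoly s Z = 0) : Z = 0 := by
  have hrow : ∀ β, ∑ γ : s, Z β γ • monomial γ.1 (1 : ℝ) = 0 := by
    intro β
    apply MvPolynomial.funext
    intro x
    have h0 := eval_gramPoly Z x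
    rw [h, map_zero] at h0
    have h1 := congrFun ((hZ.dotProduct_mulVec_zero_iff _).1 h0.symm) β
    simpa only [map_sum, smul_eval, mulVec, dotProduct, monomialVec, map_zero, Pi.zero_apply] using h1
  ext β γ
  have h2 := congrArg (coeff γ.1) (hrow β)
  simpa [coeff_sum, coeff_monomial, Subtype.coe_inj] using h2

theorem totalDegree_gramPoly_le {e : ℕ} (hs : ∀ β ∈ s, β.degree ≤ e) (Z : Matrix s s ℝ) :
    (gramPoly s Z).totalDegree ≤ 2 * e := by
  rw [gramPoly_apply]
  refine totalDegree_finsetSum_le fun β _ => totalDegree_finsetSum_le fun γ _ => ?_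
  refine (totalDegree_smul_le _ _).trans ((totalDegree_mul _ _).trans ?_)
  rw [totalDegree_monomial _ one_ne_zero, totalDegree_monomial _ one_ne_zero]
  have h1 := hs _ β.2
  have h2 := hs _ γ.2
  change (β.1 : Fin n →₀ ℕ).degree + (γ.1 : Fin n →₀ ℕ).degree ≤ _
  omega

end Gram

/-- By the Schur product theorem the entrywise product is positive semidefinite; the inner product
is its quadratic form at the all-ones vector. -/
theorem matInner_nonneg {ι : Type*} [Fintype ι] {A B : Matrix ι ι ℝ} (hA : A.PosSemidef)
    (hB : B.PosSemidef) : 0 ≤ matInner A B := by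
  have h := (hA.hadamard hB).dotProduct_mulVec_nonneg 1
  simpa [dotProduct, mulVec, matInner] using h

theorem matInner_vecMulVec {ι : Type*} [Fintype ι] (x : ι → ℝ) (B : Matrix ι ι ℝ) :
    matInner (vecMulVec x (star x)) B = star x ⬝ᵥ (B *ᵥ x) := by
  simp only [matInner, vecMulVec_apply, dotProduct, mulVec, Finset.mul_sum, star_trivial]
  refine Finset.sum_congr rfl fun β _ => Finset.sum_congr rfl fun γ _ => by ring

theorem eq_zero_of_eval_eq_zero_on_open {n : ℕ} {U : Set (Fin n → ℝ)} (hU : IsOpen U)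
    (hne : U.Nonempty) {p : MvPolynomial (Fin n) ℝ} (h : ∀ x ∈ U, eval x p = 0) : p = 0 := by
  obtain ⟨x, hx⟩ := hne
  obtain ⟨ε, hε, hball⟩ := Metric.isOpen_iff.1 hU x hx
  refine MvPolynomial.funext_set (fun i => Metric.ball (x i) ε) (fun i => ?_) fun y hy => ?_
  · rw [Real.ball_eq_Ioo]
    exact Set.Ioo_infinite (by linarith)
  · rw [map_zero]
    refine h y (hball ?_)
    rw [ball_pi _ hε]
    exact hy

/-- The linear functional on polynomials with `x^α ↦ z_α`. -/
noncomputable def riesz {n : ℕ} (z : (Fin n →₀ ℕ) → ℝ) : MvPolynomial (Fin n) ℝ →ₗ[ℝ] ℝ :=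
  (basisMonomials (Fin n) ℝ).constr ℝ z

/-! ### The Riesz functional of a sequence and its moment and localizing matrices -/

section Riesz

variable {n : ℕ} (z : (Fin n →₀ ℕ) → ℝ)

theorem riesz_monomial (α : Fin n →₀ ℕ) (r : ℝ) : riesz z (monomial α r) = r * z α := by
  have h : riesz z (monomial α 1) = z α := by
    have := (basisMonomials (Fin n) ℝ).constr_basis ℝ z α
    rwa [coe_basisMonomials] at this
  have h2 : monomial α r = r • (monomial α (1 : ℝ)) := by rw [smul_monomial, smul_eq_mul, mul_one]
  rw [h2, map_smul, h, smul_eq_mul]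

theorem riesz_eq_sum (p : MvPolynomial (Fin n) ℝ) :
    riesz z p = ∑ α ∈ p.support, p.coeff α * z α := by
  conv_lhs => rw [p.as_sum]
  simp only [map_sum, riesz_monomial]

theorem riesz_eq_sum_of_subset {p : MvPolynomial (Fin n) ℝ} {t : Finset (Fin n →₀ ℕ)}
    (h : ∀ α ∉ t, p.coeff α = 0) : riesz z p = ∑ α ∈ t, p.coeff α * z α := by
  rw [riesz_eq_sum]
  refine Finset.sum_subset (fun α hα => ?_) fun α _ hα => ?_
  · by_contra hn
    exact mem_support_iff.1 hα (h α hn)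
  · rw [notMem_support_iff.1 hα, zero_mul]

theorem riesz_gramPoly (d : ℕ) (Z : Matrix (multiIdx n d 0) (multiIdx n d 0) ℝ) :
    riesz z (gramPoly _ Z) = matInner Z (momentMatrix d z) := by
  have h := map_mul_gramPoly (riesz z) 1 Z
  rw [one_mul] at h
  rw [h]
  congr 1
  ext β γ
  rw [one_mul, monomial_mul, riesz_monomial, momentMatrix]
  ring

theorem riesz_mul_monomial (p : MvPolynomial (Fin n) ℝ) (α : Fin n →₀ ℕ) :
    riesz z (p * monomial α 1) = ∑ δ ∈ p.support, p.coeff δ * z (α + δ) := by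
  conv_lhs => rw [p.as_sum]
  simp only [Finset.sum_mul, monomial_mul, map_sum, riesz_monomial, mul_one, add_comm α]

theorem riesz_mul_gramPoly (d : ℕ) (p : MvPolynomial (Fin n) ℝ)
    (Z : Matrix (multiIdx n d (halfDeg p)) (multiIdx n d (halfDeg p)) ℝ) :
    riesz z (p * gramPoly _ Z) = matInner Z (localizingMatrix d p z) := by
  rw [map_mul_gramPoly]
  congr 1
  ext β γ
  rw [monomial_mul, mul_one, riesz_mul_monomial, localizingMatrix]

end Riesz

/-! ### Certificates in the truncated quadratic module and their duality with moment sequences -/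

section Cert

variable {n m : ℕ}

/-- The space of all matrix variables `Z_0, Z_1, …, Z_m`. -/
abbrev MatVars (g : Fin m → MvPolynomial (Fin n) ℝ) (d : ℕ) :=
  Matrix (multiIdx n d 0) (multiIdx n d 0) ℝ ×
    ∀ j : Fin m, Matrix (multiIdx n d (halfDeg (g j))) (multiIdx n d (halfDeg (g j))) ℝ

/-- The polynomial `v(x)ᵀ Z_0 v(x) + ∑_j g_j(x) v_j(x)ᵀ Z_j v_j(x)`. -/
noncomputable def certPoly (g : Fin m → MvPolynomial (Fin n) ℝ) (d : ℕ) :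
    MatVars g d →ₗ[ℝ] MvPolynomial (Fin n) ℝ where
  toFun Z := gramPoly _ Z.1 + ∑ j, g j * gramPoly _ (Z.2 j)
  map_add' Z W := by
    simp only [Prod.fst_add, Prod.snd_add, Pi.add_apply, map_add, mul_add, Finset.sum_add_distrib]
    abel
  map_smul' r Z := by
    simp only [Prod.smul_fst, Prod.smul_snd, Pi.smul_apply, map_smul, mul_smul_comm,
      Finset.smul_sum, RingHom.id_apply, smul_add]

variable (g : Fin m → MvPolynomial (Fin n) ℝ) (d : ℕ)

theorem certPoly_apply (Z : MatVars g d) :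
    certPoly g d Z = gramPoly _ Z.1 + ∑ j, g j * gramPoly _ (Z.2 j) := rfl

theorem coeff_certPoly (Z : MatVars g d) (α : Fin n →₀ ℕ) :
    coeff α (certPoly g d Z) = matInner Z.1 (momentCoeff n d α) +
      ∑ j, matInner (Z.2 j) (localizingCoeff d (g j) α) := by
  rw [certPoly_apply, coeff_add, coeff_sum]
  congr 1
  · have h := map_mul_gramPoly (lcoeff ℝ α) 1 Z.1
    simp only [one_mul] at h
    exact h
  · exact Finset.sum_congr rfl fun j _ => map_mul_gramPoly (lcoeff ℝ α) (g j) (Z.2 j)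

theorem riesz_certPoly (Z : MatVars g d) (z : (Fin n →₀ ℕ) → ℝ) :
    riesz z (certPoly g d Z) = matInner Z.1 (momentMatrix d z) +
      ∑ j, matInner (Z.2 j) (localizingMatrix d (g j) z) := by
  rw [certPoly_apply, map_add, map_sum, riesz_gramPoly]
  simp only [riesz_mul_gramPoly]

/-- All the matrices `Z_0, Z_1, …, Z_m` are positive semidefinite. -/
def PsdVars : Set (MatVars g d) := {Z | Z.1.PosSemidef ∧ ∀ j, (Z.2 j).PosSemidef}

variable {g d}

theorem riesz_certPoly_nonneg {Z : MatVars g d} (hZ : Z ∈ PsdVars g d) {z : (Fin n →₀ ℕ) → ℝ}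
    (hz : MomentFeasible g d z) : 0 ≤ riesz z (certPoly g d Z) := by
  rw [riesz_certPoly]
  exact add_nonneg (matInner_nonneg hZ.1 hz.1)
    (Finset.sum_nonneg fun j _ => matInner_nonneg (hZ.2 j) (hz.2 j))

/-- Testing on a rank-one matrix x xᵀ in a single block, with zeros elsewhere, recovers the
quadratic form of the corresponding moment or localizing matrix. -/
theorem momentFeasible_of_riesz_nonneg {z : (Fin n →₀ ℕ) → ℝ}
    (h : ∀ Z ∈ PsdVars g d, 0 ≤ riesz z (certPoly g d Z)) : MomentFeasible g d z := by
  classical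
  refine ⟨PosSemidef.of_dotProduct_mulVec_nonneg ?_ fun x => ?_, fun j =>
    PosSemidef.of_dotProduct_mulVec_nonneg ?_ fun x => ?_⟩
  · ext β γ
    simp [momentMatrix, add_comm]
  · have h1 := h (vecMulVec x (star x), 0) ⟨posSemidef_vecMulVec_self_star x, fun _ => .zero⟩
    rw [riesz_certPoly, matInner_vecMulVec] at h1
    simpa [matInner] using h1
  · ext β γ
    simp [localizingMatrix, add_comm]
  · have h1 := h (0, Pi.single j (vecMulVec x (star x))) ⟨.zero, fun i => by
      rcases eq_or_ne i j with rfl | hij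
      · dsimp only
        rw [Pi.single_eq_same]
        exact posSemidef_vecMulVec_self_star x
      · dsimp only
        rw [Pi.single_eq_of_ne hij]
        exact .zero⟩
    rw [riesz_certPoly, Finset.sum_eq_single j] at h1
    · simp only [Pi.single_eq_same, matInner_vecMulVec] at h1
      simpa [matInner] using h1
    · intro i _ hij
      simp only [Pi.single_eq_of_ne hij]
      simp [matInner]
    · simp

theorem totalDegree_certPoly_le (Z : MatVars g d) : (certPoly g d Z).totalDegree ≤ 2 * d := by
  rw [certPoly_apply]
  refine (totalDegree_add _ _).trans (max_le ?_ (totalDegree_finsetSum_le fun j _ => ?_))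
  · exact totalDegree_gramPoly_le (fun β hβ => by simpa using mem_multiIdx.1 hβ) _
  · by_cases hd : halfDeg (g j) ≤ d
    · refine (totalDegree_mul _ _).trans ?_
      have h1 := totalDegree_gramPoly_le (e := d - halfDeg (g j))
        (fun β hβ => by have := mem_multiIdx.1 hβ; omega) (Z.2 j)
      have h2 : (g j).totalDegree ≤ 2 * halfDeg (g j) := by rw [halfDeg]; omega
      omega
    -- When v_j > d the degree of `g j` may exceed 2d, but the block is empty and the summand is 0.
    · have : IsEmpty (multiIdx n d (halfDeg (g j))) :=
        ⟨fun β => hd (by have := mem_multiIdx.1 β.2; omega)⟩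
      rw [Subsingleton.elim (Z.2 j) 0, map_zero, mul_zero, totalDegree_zero]
      exact Nat.zero_le _

/-- This is where the nonempty interior of K enters. A sum of terms nonnegative on K can vanish only
termwise, and a polynomial vanishing on a nonempty open set is 0; a nonzero `g j` then cancels. The
hypothesis `hg` is needed because a block with `g j = 0` does not affect the certificate. -/
theorem eq_zero_of_certPoly_eq_zero (hK : (interior (feasibleSet g)).Nonempty) {Z : MatVars g d}
    (hZ : Z ∈ PsdVars g d) (hg : ∀ j, g j = 0 → Z.2 j = 0) (h : certPoly g d Z = 0) : Z = 0 := by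
  have hnn : ∀ x ∈ interior (feasibleSet g), ∀ j ∈ Finset.univ,
      0 ≤ eval x (g j * gramPoly _ (Z.2 j)) := fun x hx j _ => by
    rw [map_mul]
    exact mul_nonneg (interior_subset hx j) (eval_gramPoly_nonneg (hZ.2 j) x)
  have heval : ∀ x ∈ interior (feasibleSet g), eval x (gramPoly _ Z.1) = 0 ∧
      ∑ j, eval x (g j * gramPoly _ (Z.2 j)) = 0 := fun x hx => by
    have h0 := congrArg (eval x) h
    rw [certPoly_apply, map_add, map_sum, map_zero] at h0
    exact (add_eq_zero_iff_of_nonneg (eval_gramPoly_nonneg hZ.1 x)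
      (Finset.sum_nonneg (hnn x hx))).1 h0
  refine Prod.ext ?_ (funext fun j => ?_)
  · exact eq_zero_of_gramPoly_eq_zero hZ.1 <|
      eq_zero_of_eval_eq_zero_on_open isOpen_interior hK fun x hx => (heval x hx).1
  · by_cases hgj : g j = 0
    · exact hg j hgj
    · refine eq_zero_of_gramPoly_eq_zero (hZ.2 j) ?_
      have h1 : g j * gramPoly _ (Z.2 j) = 0 :=
        eq_zero_of_eval_eq_zero_on_open isOpen_interior hK fun x hx =>
          (Finset.sum_eq_zero_iff_of_nonneg (hnn x hx)).1 (heval x hx).2 j (Finset.mem_univ j)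
      exact (mul_eq_zero.1 h1).resolve_left hgj

end Cert

/-! ### Closedness of linear images of cones -/

section ClosedCone

/-- A linear map on a finite-dimensional space which vanishes on a closed cone only at `0` maps
that cone to a closed set. -/
theorem isClosed_image_of_closed_cone {V E : Type*} [NormedAddCommGroup V] [NormedSpace ℝ V]
    [FiniteDimensional ℝ V] [NormedAddCommGroup E] [NormedSpace ℝ E] (L : V →ₗ[ℝ] E) {P : Set V}
    (hP : IsClosed P) (hsmul : ∀ r : ℝ, 0 ≤ r → ∀ x ∈ P, r • x ∈ P)
    (hker : ∀ x ∈ P, L x = 0 → x = 0) : IsClosed (L '' P) := by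
  have : ProperSpace V := FiniteDimensional.proper ℝ V
  have hL : Continuous L := L.continuous_of_finiteDimensional
  -- The constant is the minimum of ‖L x‖ over unit vectors of the cone, positive by `hker`; if
  -- there are none, the cone lies in {0} and any constant works.
  obtain ⟨c, hc, hbound⟩ : ∃ c > 0, ∀ x ∈ P, c * ‖x‖ ≤ ‖L x‖ := by
    have hcpt : IsCompact (P ∩ Metric.sphere 0 1) := (isCompact_sphere 0 1).inter_left hP
    rcases (P ∩ Metric.sphere (0 : V) 1).eq_empty_or_nonempty with he | hne
    · refine ⟨1, one_pos, fun x hx => ?_⟩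
      have hx0 : x = 0 := by
        by_contra hx0
        refine Set.eq_empty_iff_forall_notMem.1 he (‖x‖⁻¹ • x) ⟨hsmul _ (by positivity) x hx, ?_⟩
        rw [mem_sphere_zero_iff_norm, norm_smul, norm_inv, norm_norm,
          inv_mul_cancel₀ (norm_ne_zero_iff.2 hx0)]
      simp [hx0]
    · obtain ⟨y, hy, hmin⟩ := hcpt.exists_isMinOn hne hL.norm.continuousOn
      have hy1 : ‖y‖ = 1 := mem_sphere_zero_iff_norm.1 hy.2
      refine ⟨‖L y‖, norm_pos_iff.2 fun h0 => ?_, fun x hx => ?_⟩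
      · rw [hker y hy.1 h0, norm_zero] at hy1
        exact zero_ne_one hy1
      · rcases eq_or_ne x 0 with rfl | hx0
        · simp
        · have hxn : 0 < ‖x‖ := norm_pos_iff.2 hx0
          have h1 : ‖L y‖ ≤ ‖L (‖x‖⁻¹ • x)‖ := hmin ⟨hsmul _ (by positivity) x hx, by
            rw [mem_sphere_zero_iff_norm, norm_smul, norm_inv, norm_norm,
              inv_mul_cancel₀ hxn.ne']⟩
          rw [map_smul, norm_smul, norm_inv, norm_norm, inv_mul_eq_div, le_div_iff₀ hxn] at h1
          exact h1
  refine isClosed_of_closure_subset fun y hy => ?_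
  -- Image points within distance 1 of y have norm at most ‖y‖ + 1, so their preimages in P lie in
  -- this ball, and y is in the closure of a compact set.
  have hcpt : IsCompact (L '' (P ∩ Metric.closedBall 0 ((‖y‖ + 1) / c))) :=
    ((isCompact_closedBall _ _).inter_left hP).image hL
  have hmem : y ∈ closure (L '' (P ∩ Metric.closedBall 0 ((‖y‖ + 1) / c))) := by
    have h1 : y ∈ closure (Metric.ball y 1 ∩ L '' P) :=
      Metric.isOpen_ball.inter_closure ⟨Metric.mem_ball_self one_pos, hy⟩
    refine closure_mono ?_ h1
    rintro _ ⟨hb, x, hx, rfl⟩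
    refine ⟨x, ⟨hx, ?_⟩, rfl⟩
    rw [mem_closedBall_zero_iff, le_div_iff₀ hc, mul_comm]
    refine (hbound x hx).trans ?_
    have h2 : ‖L x - y‖ < 1 := by rwa [← dist_eq_norm]
    have h3 := norm_sub_norm_le (L x) y
    linarith
  rw [hcpt.isClosed.closure_eq] at hmem
  exact Set.image_mono Set.inter_subset_left hmem

end ClosedCone

theorem isClosed_posSemidef {ι : Type*} [Fintype ι] :
    IsClosed {M : Matrix ι ι ℝ | M.PosSemidef} := by
  simp only [posSemidef_iff_dotProduct_mulVec, Set.ofPred_and, Set.ofPred_forall]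
  refine IsClosed.inter (isClosed_eq continuous_id.matrix_conjTranspose continuous_id)
    (isClosed_iInter fun x => isClosed_le continuous_const ?_)
  exact continuous_const.dotProduct (continuous_id.matrix_mulVec continuous_const)

/-! ### The truncated quadratic module is a closed convex cone -/

section TruncatedModule

open scoped Matrix.Norms.Elementwise

variable {n m : ℕ} (g : Fin m → MvPolynomial (Fin n) ℝ) (d : ℕ) (I : Finset (Fin n →₀ ℕ))

/-- The coefficients with exponent in `I` of the polynomials `certPoly g d Z`. -/
noncomputable def certCoeff : MatVars g d →ₗ[ℝ] (I → ℝ) :=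
  LinearMap.pi fun α => (lcoeff ℝ α.1).comp (certPoly g d)

/-- The coefficient vectors of the truncated quadratic module generated by `g`. -/
def truncModule : Set (I → ℝ) := certCoeff g d I '' PsdVars g d

variable {g d I}

theorem certCoeff_apply (Z : MatVars g d) (α : I) :
    certCoeff g d I Z α = coeff α.1 (certPoly g d Z) := rfl

theorem smul_mem_psdVars {Z : MatVars g d} (hZ : Z ∈ PsdVars g d) {r : ℝ} (hr : 0 ≤ r) :
    r • Z ∈ PsdVars g d := ⟨hZ.1.smul hr, fun j => (hZ.2 j).smul hr⟩

theorem convex_psdVars : Convex ℝ (PsdVars g d) := fun _ hZ _ hW _ _ ha hb _ =>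
  ⟨(hZ.1.smul ha).add (hW.1.smul hb), fun j => ((hZ.2 j).smul ha).add ((hW.2 j).smul hb)⟩

theorem convex_truncModule : Convex ℝ (truncModule g d I) :=
  convex_psdVars.linear_image _

theorem zero_mem_psdVars : (0 : MatVars g d) ∈ PsdVars g d := ⟨.zero, fun _ => .zero⟩

theorem zero_mem_truncModule : (0 : I → ℝ) ∈ truncModule g d I :=
  ⟨0, zero_mem_psdVars, map_zero _⟩

theorem smul_mem_truncModule {q : I → ℝ} (hq : q ∈ truncModule g d I) {r : ℝ} (hr : 0 ≤ r) :
    r • q ∈ truncModule g d I := by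
  obtain ⟨Z, hZ, rfl⟩ := hq
  exact ⟨r • Z, smul_mem_psdVars hZ hr, map_smul _ _ _⟩

theorem coeff_certPoly_eq_zero (hI : multiIdx n (2 * d) 0 ⊆ I) (Z : MatVars g d)
    {α : Fin n →₀ ℕ} (hα : α ∉ I) : coeff α (certPoly g d Z) = 0 := by
  refine coeff_eq_zero_of_totalDegree_lt ((totalDegree_certPoly_le Z).trans_lt ?_)
  by_contra hn
  refine hα (hI (mem_multiIdx.2 ?_))
  rw [Finsupp.degree_apply]
  omega

theorem isClosed_truncModule (hK : (interior (feasibleSet g)).Nonempty)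
    (hI : multiIdx n (2 * d) 0 ⊆ I) : IsClosed (truncModule g d I) := by
  classical
  have himage : truncModule g d I =
      certCoeff g d I '' {Z | Z ∈ PsdVars g d ∧ ∀ j, g j = 0 → Z.2 j = 0} := by
    refine Set.Subset.antisymm ?_ (Set.image_mono fun _ h => h.1)
    rintro _ ⟨Z, hZ, rfl⟩
    -- Erasing the blocks with `g j = 0` leaves the certificate unchanged and makes the kernel
    -- condition of the closed-cone lemma hold.
    let W : MatVars g d := (Z.1, fun j => if g j = 0 then 0 else Z.2 j)
    have hW : ∀ j, W.2 j = if g j = 0 then 0 else Z.2 j := fun _ => rfl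
    have hcert : certPoly g d W = certPoly g d Z := by
      rw [certPoly_apply, certPoly_apply]
      refine congrArg₂ _ rfl (Finset.sum_congr rfl fun j _ => ?_)
      by_cases hj : g j = 0
      · simp [hj]
      · rw [hW, if_neg hj]
    refine ⟨W, ⟨⟨hZ.1, fun j => ?_⟩, fun j hj => (hW j).trans (if_pos hj)⟩, ?_⟩
    · rw [hW]
      split_ifs
      exacts [.zero, hZ.2 j]
    · funext α
      rw [certCoeff_apply, certCoeff_apply, hcert]
  rw [himage]
  refine isClosed_image_of_closed_cone _ ?_ ?_ ?_
  · have h1 : IsClosed {Z : MatVars g d | Z.1.PosSemidef} :=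
      isClosed_posSemidef.preimage continuous_fst
    have h2 : ∀ j, IsClosed {Z : MatVars g d | (Z.2 j).PosSemidef} := fun j =>
      isClosed_posSemidef.preimage (by fun_prop : Continuous fun Z : MatVars g d => Z.2 j)
    have h3 : ∀ j, IsClosed {Z : MatVars g d | Z.2 j = 0} := fun j =>
      isClosed_eq (by fun_prop) continuous_const
    simp only [PsdVars, Set.ofPred_and, Set.ofPred_forall]
    exact (h1.inter (isClosed_iInter h2)).inter
      (isClosed_iInter fun j => isClosed_iInter fun _ => h3 j)
  · rintro r hr Z ⟨hZ, h0⟩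
    refine ⟨smul_mem_psdVars hZ hr, fun j hj => ?_⟩
    rw [Prod.smul_snd, Pi.smul_apply, h0 j hj, smul_zero]
  · rintro Z ⟨hZ, h0⟩ hZ0
    refine eq_zero_of_certPoly_eq_zero hK hZ h0 (MvPolynomial.ext _ _ fun α => ?_)
    rw [coeff_zero]
    by_cases hα : α ∈ I
    · exact congrFun hZ0 ⟨α, hα⟩
    · exact coeff_certPoly_eq_zero hI Z hα

end TruncatedModule

/-! ### Attainment of the minimum and separation by a moment sequence -/

section Separation

variable {n m : ℕ} {g : Fin m → MvPolynomial (Fin n) ℝ} {d : ℕ} {S I : Finset (Fin n →₀ ℕ)}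

/-- Extension of a vector indexed by `S` by zero to the index set `I`. -/
noncomputable def extendZero (S I : Finset (Fin n →₀ ℕ)) : (S → ℝ) →ₗ[ℝ] (I → ℝ) :=
  LinearMap.pi fun α => if h : α.1 ∈ S then LinearMap.proj (⟨α.1, h⟩ : S) else 0

theorem extendZero_apply_of_mem (a : S → ℝ) {α : I} (h : α.1 ∈ S) :
    extendZero S I a α = a ⟨α.1, h⟩ := by
  simp [extendZero, h]

theorem extendZero_apply_of_notMem (a : S → ℝ) {α : I} (h : α.1 ∉ S) :
    extendZero S I a α = 0 := by
  simp [extendZero, h]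

theorem continuous_extendZero : Continuous (extendZero S I) :=
  (extendZero S I).continuous_of_finiteDimensional

/-- A continuous function with bounded sublevel sets attains its minimum over the polynomials with
exponents in `S` which lie in the truncated quadratic module. -/
theorem exists_isMinOn_truncModule (hK : (interior (feasibleSet g)).Nonempty)
    (hI : multiIdx n (2 * d) 0 ⊆ I) {φ : (S → ℝ) → ℝ} (hφ : Continuous φ)
    (hb : ∀ c, Bornology.IsBounded {a | φ a ≤ c}) :
    ∃ a ∈ extendZero S I ⁻¹' truncModule g d I,
      IsMinOn φ (extendZero S I ⁻¹' truncModule g d I) a := by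
  have hcl : IsClosed (extendZero S I ⁻¹' truncModule g d I) :=
    (isClosed_truncModule hK hI).preimage continuous_extendZero
  have h0 : (0 : S → ℝ) ∈ extendZero S I ⁻¹' truncModule g d I := by
    rw [Set.mem_preimage, map_zero]
    exact zero_mem_truncModule
  have hcpt : IsCompact (extendZero S I ⁻¹' truncModule g d I ∩ {a | φ a ≤ φ 0}) :=
    (Metric.isCompact_of_isClosed_isBounded (isClosed_le hφ continuous_const)
      (hb (φ 0))).inter_left hcl
  obtain ⟨a, ha, hmin⟩ := hcpt.exists_isMinOn ⟨0, h0, le_refl (φ 0)⟩ hφ.continuousOn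
  refine ⟨a, ha.1, fun b hbm => ?_⟩
  by_cases h : φ b ≤ φ 0
  · exact hmin ⟨hbm, h⟩
  · exact le_trans ha.2 (not_le.1 h).le

/-- A nonempty sublevel set of a convex function which is disjoint from the truncated quadratic
module is separated from it by a feasible moment sequence. -/
theorem exists_momentFeasible_separating (hK : (interior (feasibleSet g)).Nonempty)
    (hI : multiIdx n (2 * d) 0 ⊆ I) (hSI : S ⊆ I) {φ : (S → ℝ) → ℝ} (hφ : Continuous φ)
    (hconv : ConvexOn ℝ Set.univ φ) (hb : ∀ c, Bornology.IsBounded {a | φ a ≤ c}) {c : ℝ}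
    (hc : ∀ a ∈ extendZero S I ⁻¹' truncModule g d I, c < φ a) :
    ∃ z, MomentFeasible g d z ∧ ∀ a : S → ℝ, φ a ≤ c → ∑ α, z α.1 * a α < 0 := by
  classical
  have hcpt : IsCompact (extendZero S I '' {a | φ a ≤ c}) :=
    (Metric.isCompact_of_isClosed_isBounded (isClosed_le hφ continuous_const)
      (hb c)).image continuous_extendZero
  have hcvx : Convex ℝ (extendZero S I '' {a | φ a ≤ c}) := by
    have h := hconv.convex_le c
    simp only [Set.mem_univ, true_and] at h
    exact h.linear_image _
  obtain ⟨ℓ, u, v, hu, huv, hv⟩ := geometric_hahn_banach_compact_closed hcvx hcpt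
    (convex_truncModule (g := g) (d := d) (I := I)) (isClosed_truncModule hK hI) (by
      rw [Set.disjoint_left]
      rintro _ ⟨a, ha, rfl⟩ hmem
      exact (hc a hmem).not_ge ha)
  have hv0 : v < 0 := by simpa using hv 0 zero_mem_truncModule
  -- A functional bounded below on a cone is nonnegative there: if ℓ q < 0, the multiple (v / ℓ q) q
  -- has value exactly v, against the strict bound.
  have hnn : ∀ q ∈ truncModule g d I, 0 ≤ ℓ q := fun q hq => by
    by_contra! hneg
    have h1 := hv _ (smul_mem_truncModule hq (div_nonneg_of_nonpos hv0.le hneg.le))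
    rw [map_smul, smul_eq_mul, div_mul_cancel₀ _ hneg.ne] at h1
    exact lt_irrefl _ h1
  -- The value outside `I` is immaterial, since certificates have no exponents there.
  let z : (Fin n →₀ ℕ) → ℝ := fun α => if h : α ∈ I then ℓ (Pi.single ⟨α, h⟩ 1) else 0
  have hz : ∀ α : I, z α.1 = ℓ (Pi.single α 1) := fun α => dif_pos α.2
  have hℓ : ∀ q, ℓ q = ∑ α, q α * z α.1 := fun q => by
    simp only [hz]
    conv_lhs => rw [pi_eq_sum_univ' q]
    simp only [map_sum, map_smul, smul_eq_mul]
  refine ⟨z, momentFeasible_of_riesz_nonneg fun Z hZ => ?_, fun a ha => ?_⟩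
  · rw [riesz_eq_sum_of_subset z (t := I) fun α hα => coeff_certPoly_eq_zero hI Z hα,
      ← Finset.sum_coe_sort]
    have h1 := hnn _ ⟨Z, hZ, rfl⟩
    rwa [hℓ] at h1
  · have h1 := (hu _ ⟨a, ha, rfl⟩).trans (huv.trans hv0)
    rw [hℓ] at h1
    refine lt_of_eq_of_lt ?_ h1
    let F : (Fin n →₀ ℕ) → ℝ := fun α => if h : α ∈ S then a ⟨α, h⟩ * z α else 0
    have h2 : ∑ α : I, extendZero S I a α * z α.1 = ∑ α ∈ I, F α := by
      rw [← Finset.sum_coe_sort I F]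
      refine Finset.sum_congr rfl fun α _ => ?_
      by_cases h : α.1 ∈ S
      · rw [extendZero_apply_of_mem a h]
        simp [F, h]
      · rw [extendZero_apply_of_notMem a h, zero_mul]
        simp [F, h]
    rw [h2, ← Finset.sum_subset hSI fun α _ h => dif_neg h, ← Finset.sum_coe_sort S F]
    refine Finset.sum_congr rfl fun α _ => ?_
    rw [mul_comm]
    simp [F]

end Separation

/-! ### Reduction of the programs to distance minimization over the cone -/

section Programs

variable {n m : ℕ}

theorem mem_nzIdx {e : ℕ} {α : Fin n →₀ ℕ} : α ∈ nzIdx n e ↔ ¬(α = 0 ∨ e < α.degree) := by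
  rw [nzIdx, Finset.mem_erase, mem_multiIdx, not_or, not_lt, add_zero]

/-- The coefficients of `p` with exponents in `ℕⁿ_e \ {0}`. -/
def coeffVec (e : ℕ) (p : MvPolynomial (Fin n) ℝ) : nzIdx n e → ℝ := fun α => p.coeff α.1

variable {g : Fin m → MvPolynomial (Fin n) ℝ} {d e : ℕ}

theorem CertVars.Feasible.coeffVec_mem {I : Finset (Fin n →₀ ℕ)} {c : CertVars g d}
    (hc : c.Feasible e) :
    coeffVec e c.ft ∈ extendZero (nzIdx n e) I ⁻¹' truncModule g d I := by
  refine ⟨(c.Z0, c.Z), ⟨hc.2.1, hc.2.2.1⟩, funext fun α => ?_⟩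
  rw [certCoeff_apply, coeff_certPoly]
  refine (hc.2.2.2 α.1).trans ?_
  by_cases h : α.1 ∈ nzIdx n e
  · rw [extendZero_apply_of_mem _ h, if_neg (mem_nzIdx.1 h)]
    rfl
  · rw [extendZero_apply_of_notMem _ h, if_pos (not_not.1 (mt mem_nzIdx.2 h))]

theorem exists_feasible_of_mem {I : Finset (Fin n →₀ ℕ)} (hI : multiIdx n (2 * d) 0 ⊆ I)
    (hSI : nzIdx n e ⊆ I) {a : nzIdx n e → ℝ}
    (ha : a ∈ extendZero (nzIdx n e) I ⁻¹' truncModule g d I) :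
    ∃ c : CertVars g d, c.Feasible e ∧ coeffVec e c.ft = a := by
  classical
  obtain ⟨Z, hZ, hZa⟩ := ha
  have hcoeff : ∀ α : nzIdx n e, coeff α.1 (∑ β : nzIdx n e, monomial β.1 (a β)) = a α :=
    fun α => by simp [coeff_sum, coeff_monomial]
  refine ⟨⟨∑ β : nzIdx n e, monomial β.1 (a β), Z.1, Z.2⟩, ⟨?_, hZ.1, hZ.2, fun α => ?_⟩,
    funext hcoeff⟩
  · refine totalDegree_finsetSum_le fun β _ => (totalDegree_monomial_le _ _).trans ?_
    have := not_or.1 (mem_nzIdx.1 β.2)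
    exact not_lt.1 this.2
  · rw [← coeff_certPoly]
    by_cases hS : α ∈ nzIdx n e
    · rw [if_neg (mem_nzIdx.1 hS), hcoeff ⟨α, hS⟩, ← certCoeff_apply (I := I) Z ⟨α, hSI hS⟩, hZa,
        extendZero_apply_of_mem a hS]
    · rw [if_pos (not_not.1 (mt mem_nzIdx.2 hS))]
      by_cases hα : α ∈ I
      · rw [← certCoeff_apply (I := I) Z ⟨α, hα⟩, hZa, extendZero_apply_of_notMem a hS]
      · exact coeff_certPoly_eq_zero hI Z hα

/-- The heart of weak duality: by (C) this sum is the Riesz functional of the certificate, the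
coefficients outside S being 0. -/
theorem CertVars.Feasible.sum_mul_coeff_nonneg {c : CertVars g d} (hc : c.Feasible e)
    {z : (Fin n →₀ ℕ) → ℝ} (hz : MomentFeasible g d z) :
    0 ≤ ∑ α, z α.1 * coeffVec e c.ft α := by
  have h1 := riesz_certPoly_nonneg (Z := (c.Z0, c.Z)) ⟨hc.2.1, hc.2.2.1⟩ hz
  have h2 : ∀ α, coeff α (certPoly g d (c.Z0, c.Z)) =
      if α = 0 ∨ e < α.degree then 0 else c.ft.coeff α := fun α => by
    rw [coeff_certPoly]
    exact hc.2.2.2 α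
  rw [riesz_eq_sum_of_subset z (t := nzIdx n e) fun α hα => by
    rw [h2, if_pos (not_not.1 (mt mem_nzIdx.2 hα))], ← Finset.sum_coe_sort] at h1
  refine h1.trans_eq (Finset.sum_congr rfl fun α _ => ?_)
  rw [h2, if_neg (mem_nzIdx.1 α.2), mul_comm, coeffVec]

theorem noDualityGap_of_weak_of_strong {X Y : Type*} {P : Set X} {φ : X → ℝ} {D : Set Y}
    {ψ : Y → ℝ} (hweak : ∀ p ∈ P, ∀ q ∈ D, ψ q ≤ φ p)
    (hstrong : ∀ c, (∀ p ∈ P, c < φ p) → ∃ q ∈ D, c ≤ ψ q) : NoDualityGap P φ D ψ := by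
  refine le_antisymm ?_ ?_
  · by_contra! hlt
    obtain ⟨c, hc1, hc2⟩ := EReal.lt_iff_exists_real_btwn.1 hlt
    obtain ⟨q, hq, hcq⟩ := hstrong c fun p hp =>
      EReal.coe_lt_coe_iff.1 (hc2.trans_le (iInf₂_le p hp))
    refine absurd hc1 (not_lt.2 (le_trans ?_ (le_iSup₂ q hq)))
    exact EReal.coe_le_coe_iff.2 hcq
  · exact iSup₂_le fun q hq => le_iInf₂ fun p hp => EReal.coe_le_coe_iff.2 (hweak p hp q hq)

/-- The three cases differ only in φ and in how the dual variables encode it, so the argument about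
the cone is made once. `hlower` and `hupper` eliminate the slack variables of the primal; the last
three hypotheses are what remains to be checked on the dual side. -/
theorem noDualityGap_and_hasOptimalSolution (hK : (interior (feasibleSet g)).Nonempty)
    {X Y : Type*} {P : Set X} {obj : X → ℝ} {D : Set Y} {ψ : Y → ℝ} {φ : (nzIdx n e → ℝ) → ℝ}
    (hφ : Continuous φ) (hconv : ConvexOn ℝ Set.univ φ)
    (hb : ∀ c, Bornology.IsBounded {a | φ a ≤ c})
    (hlower : ∀ p ∈ P, ∃ c : CertVars g d, c.Feasible e ∧ φ (coeffVec e c.ft) ≤ obj p)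
    (hupper : ∀ c : CertVars g d, c.Feasible e → ∃ p ∈ P, obj p = φ (coeffVec e c.ft))
    (hweak : ∀ q ∈ D, ∃ z, MomentFeasible g d z ∧
      ∀ a : nzIdx n e → ℝ, 0 ≤ ∑ α, z α.1 * a α → ψ q ≤ φ a)
    (hzero : ∃ q ∈ D, 0 ≤ ψ q)
    (hstrong : ∀ c, 0 ≤ c → ∀ z, MomentFeasible g d z →
      (∀ a : nzIdx n e → ℝ, φ a ≤ c → ∑ α, z α.1 * a α < 0) → ∃ q ∈ D, c ≤ ψ q) :
    NoDualityGap P obj D ψ ∧ HasOptimalSolution P obj := by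
  -- The index set must hold both the exponents of certificates, of degree at most 2d, and those of
  -- S; neither bound dominates the other in general.
  have hI : multiIdx n (2 * d) 0 ⊆ multiIdx n (max (2 * d) e) 0 := fun α hα =>
    mem_multiIdx.2 ((mem_multiIdx.1 hα).trans (le_max_left _ _))
  have hSI : nzIdx n e ⊆ multiIdx n (max (2 * d) e) 0 := fun α hα =>
    mem_multiIdx.2 ((mem_multiIdx.1 (Finset.mem_of_mem_erase hα)).trans (le_max_right _ _))
  refine ⟨noDualityGap_of_weak_of_strong ?_ fun c hc => ?_, ?_⟩
  · intro p hp q hq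
    obtain ⟨c, hc, hcp⟩ := hlower p hp
    obtain ⟨z, hz, hzq⟩ := hweak q hq
    exact (hzq _ (hc.sum_mul_coeff_nonneg hz)).trans hcp
  -- For negative levels the sublevel set may be empty and separation says nothing; a dual point of
  -- nonnegative value suffices there.
  · rcases le_total c 0 with hc0 | hc0
    · obtain ⟨q, hq, hq0⟩ := hzero
      exact ⟨q, hq, hc0.trans hq0⟩
    · obtain ⟨z, hz, hneg⟩ := exists_momentFeasible_separating (c := c) hK hI hSI hφ hconv hb
        fun a ha => by
          obtain ⟨cert, hcert, rfl⟩ := exists_feasible_of_mem hI hSI ha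
          obtain ⟨p, hp, hobj⟩ := hupper cert hcert
          exact hobj ▸ hc p hp
      exact hstrong c hc0 z hz hneg
  · obtain ⟨a, ha, hmin⟩ := exists_isMinOn_truncModule hK hI hφ hb
    obtain ⟨cert, hcert, rfl⟩ := exists_feasible_of_mem hI hSI ha
    obtain ⟨p, hp, hobj⟩ := hupper cert hcert
    refine ⟨p, hp, fun p' hp' => ?_⟩
    obtain ⟨cert', hcert', hle⟩ := hlower p' hp'
    have h1 : φ (coeffVec e cert.ft) ≤ φ (coeffVec e cert'.ft) := hmin hcert'.coeffVec_mem
    exact hobj.le.trans (h1.trans hle)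

theorem MomentFeasible.smul {z : (Fin n →₀ ℕ) → ℝ} (hz : MomentFeasible g d z) {t : ℝ}
    (ht : 0 ≤ t) : MomentFeasible g d (t • z) := by
  refine ⟨hz.1.smul ht, fun j => ?_⟩
  have h : localizingMatrix d (g j) (t • z) = t • localizingMatrix d (g j) z := by
    ext β γ
    simp only [localizingMatrix, Matrix.smul_apply, Pi.smul_apply, smul_eq_mul, Finset.mul_sum]
    exact Finset.sum_congr rfl fun δ _ => by ring
  rw [h]
  exact (hz.2 j).smul ht

theorem momentFeasible_zero : MomentFeasible g d (0 : (Fin n →₀ ℕ) → ℝ) :=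
  momentFeasible_of_riesz_nonneg fun Z _ => by simp [riesz_eq_sum]

/-! ### The three distance functions -/

section Distance

variable {ι : Type*} [Fintype ι] (f : ι → ℝ)

theorem convexOn_sum_abs_sub : ConvexOn ℝ Set.univ fun a : ι → ℝ => ∑ i, |f i - a i| := by
  refine ⟨convex_univ, fun a _ b _ s t hs ht hst => ?_⟩
  simp only [smul_eq_mul, Finset.mul_sum, ← Finset.sum_add_distrib]
  refine Finset.sum_le_sum fun i _ => ?_
  rw [← abs_of_nonneg hs, ← abs_of_nonneg ht, ← abs_mul, ← abs_mul, abs_of_nonneg hs,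
    abs_of_nonneg ht]
  refine le_trans (le_of_eq ?_) (abs_add_le _ _)
  congr 1
  simp only [Pi.add_apply, Pi.smul_apply, smul_eq_mul]
  linear_combination (-(f i)) * hst

theorem isBounded_of_abs_sub_le {s : Set (ι → ℝ)} (R : ℝ) (h : ∀ a ∈ s, ∀ i, |f i - a i| ≤ R) :
    Bornology.IsBounded s := by
  refine (Metric.isBounded_closedBall (x := f) (r := |R|)).subset fun a ha => ?_
  rw [Metric.mem_closedBall, dist_comm, dist_eq_norm, pi_norm_le_iff_of_nonneg (abs_nonneg R)]
  exact fun i => (h a ha i).trans (le_abs_self R)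

theorem convexOn_norm_sub : ConvexOn ℝ Set.univ fun a : ι → ℝ => ‖f - a‖ := by
  refine ⟨convex_univ, fun a _ b _ s t hs ht hst => ?_⟩
  have h : f - (s • a + t • b) = s • (f - a) + t • (f - b) := by
    rw [smul_sub, smul_sub, sub_add_sub_comm, ← add_smul, hst, one_smul]
  simp only [h]
  refine (norm_add_le _ _).trans_eq ?_
  rw [norm_smul, norm_smul, Real.norm_of_nonneg hs, Real.norm_of_nonneg ht, smul_eq_mul,
    smul_eq_mul]

theorem convexOn_sum_sq_sub : ConvexOn ℝ Set.univ fun a : ι → ℝ => ∑ i, (f i - a i) ^ 2 := by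
  refine ⟨convex_univ, fun a _ b _ s t hs ht hst => ?_⟩
  simp only [smul_eq_mul, Finset.mul_sum, ← Finset.sum_add_distrib]
  refine Finset.sum_le_sum fun i _ => ?_
  simp only [Pi.add_apply, Pi.smul_apply, smul_eq_mul]
  obtain rfl : t = 1 - s := by linarith
  have h := mul_nonneg (mul_nonneg hs ht) (sq_nonneg (a i - b i))
  linarith

end Distance

/-! ### The programs for `k = 1` and `k = ∞` -/

section Linear

variable (f : MvPolynomial (Fin n) ℝ)

/-- The dual point obtained from a moment sequence `z` by splitting `-z` into its positive and
negative parts. -/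
def DualVars.ofSeq (z : (Fin n →₀ ℕ) → ℝ) : DualVars f where
  u α := (-z α.1)⁺
  v α := (-z α.1)⁻
  z := z

theorem DualVars.ofSeq_add (z : (Fin n →₀ ℕ) → ℝ) (α : nzIdx n f.totalDegree) :
    (DualVars.ofSeq f z).u α + (DualVars.ofSeq f z).v α = |z α.1| :=
  (posPart_add_negPart _).trans (abs_neg _)

theorem DualVars.ofSeq_sub (z : (Fin n →₀ ℕ) → ℝ) (α : nzIdx n f.totalDegree) :
    (DualVars.ofSeq f z).u α - (DualVars.ofSeq f z).v α = -z α.1 :=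
  posPart_sub_negPart _

theorem dualObj_ofSeq (z : (Fin n →₀ ℕ) → ℝ) :
    dualObj f (DualVars.ofSeq f z) = -∑ α, z α.1 * coeffVec f.totalDegree f α := by
  rw [dualObj, ← Finset.sum_neg_distrib]
  refine Finset.sum_congr rfl fun α _ => ?_
  rw [DualVars.ofSeq_sub, coeffVec]
  ring

/-- Since u − v = −z, replacing `f` by `f − a` in the objective adds ∑ z_α a_α, which is
nonnegative. The bounds on u and v then give Hölder's inequality in each case. -/
theorem dualObj_le {q : DualVars f} (hq : ∀ α, q.u α - q.v α + q.z α.1 = 0)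
    {a : nzIdx n f.totalDegree → ℝ} (ha : 0 ≤ ∑ α, q.z α.1 * a α) :
    dualObj f q ≤ ∑ α, (q.u α - q.v α) * (coeffVec f.totalDegree f α - a α) := by
  have h : ∑ α, (q.u α - q.v α) * (coeffVec f.totalDegree f α - a α) =
      dualObj f q + ∑ α, q.z α.1 * a α := by
    rw [dualObj, ← Finset.sum_add_distrib]
    refine Finset.sum_congr rfl fun α _ => ?_
    rw [coeffVec]
    linear_combination (-(a α)) * hq α
  rw [h]
  linarith

theorem ofSeq_mem_dualFeasOne {z : (Fin n →₀ ℕ) → ℝ} (hz : MomentFeasible g d z)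
    (h1 : ∀ α : nzIdx n f.totalDegree, |z α.1| ≤ 1) :
    DualVars.ofSeq f z ∈ dualFeasOne f g d :=
  ⟨fun _ => posPart_nonneg _, fun _ => negPart_nonneg _,
    fun α => (DualVars.ofSeq_add f z α).trans_le (h1 α),
    fun α => by rw [DualVars.ofSeq_sub]; exact neg_add_cancel _, hz⟩

theorem ofSeq_mem_dualFeasTop {z : (Fin n →₀ ℕ) → ℝ} (hz : MomentFeasible g d z)
    (h1 : ∑ α : nzIdx n f.totalDegree, |z α.1| ≤ 1) :
    DualVars.ofSeq f z ∈ dualFeasTop f g d :=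
  ⟨fun _ => posPart_nonneg _, fun _ => negPart_nonneg _, by
    simp only [DualVars.ofSeq_add]; exact h1,
    fun α => by rw [DualVars.ofSeq_sub]; exact neg_add_cancel _, hz⟩

/-- Rescaling a moment sequence on which the objective is at least `c` times a gauge `N` of the
sequence gives an objective of at least `c`. -/
theorem le_dualObj_ofSeq_inv_smul {z : (Fin n →₀ ℕ) → ℝ} {c N : ℝ} (hN : 0 < N)
    (h : c * N ≤ -∑ α, z α.1 * coeffVec f.totalDegree f α) :
    c ≤ dualObj f (DualVars.ofSeq f (N⁻¹ • z)) := by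
  have h1 : dualObj f (DualVars.ofSeq f (N⁻¹ • z)) =
      (-∑ α, z α.1 * coeffVec f.totalDegree f α) / N := by
    rw [dualObj_ofSeq, div_eq_inv_mul, mul_neg, Finset.mul_sum]
    simp only [Pi.smul_apply, smul_eq_mul, mul_assoc]
  rw [h1, le_div_iff₀ hN]
  exact h

theorem sum_mul_eq_zero_of_norm_eq_zero {ι : Type*} [Fintype ι] {w : ι → ℝ} (hw : ‖w‖ = 0)
    (a : ι → ℝ) : ∑ i, w i * a i = 0 := by
  simp [norm_eq_zero.1 hw]

theorem one_program (hK : (interior (feasibleSet g)).Nonempty) :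
    NoDualityGap (primalFeasOne f g d) (primalObj f g d) (dualFeasOne f g d) (dualObj f) ∧
      HasOptimalSolution (primalFeasOne f g d) (primalObj f g d) := by
  classical
  set F := coeffVec f.totalDegree f with hF
  refine noDualityGap_and_hasOptimalSolution (d := d) (φ := fun a => ∑ α, |F α - a α|) hK
    (by fun_prop) (convexOn_sum_abs_sub F) (fun c => isBounded_of_abs_sub_le F c
      fun a ha i => le_trans ?_ ha) ?_ ?_ ?_ ?_ ?_
  · exact Finset.single_le_sum (f := fun α => |F α - a α|) (fun α _ => abs_nonneg _)
      (Finset.mem_univ i)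
  · rintro ⟨l, c⟩ ⟨-, h1, h2, hc⟩
    refine ⟨c, hc, Finset.sum_le_sum fun α _ => abs_le.2 ⟨?_, ?_⟩⟩
    · have := h2 α
      simp only [hF, coeffVec] at this ⊢
      linarith
    · have := h1 α
      simp only [hF, coeffVec] at this ⊢
      linarith
  · intro c hc
    refine ⟨(fun α => |F α - coeffVec _ c.ft α|, c),
      ⟨fun α => abs_nonneg _, fun α => ?_, fun α => ?_, hc⟩, rfl⟩
    · have := le_abs_self (F α - coeffVec _ c.ft α)
      simp only [hF, coeffVec] at this ⊢
      linarith
    · have := neg_abs_le (F α - coeffVec _ c.ft α)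
      simp only [hF, coeffVec] at this ⊢
      linarith
  · rintro q ⟨hu, hv, huv, hz, hM⟩
    refine ⟨q.z, hM, fun a ha => (dualObj_le f hz ha).trans (Finset.sum_le_sum fun α _ => ?_)⟩
    have h1 : |q.u α - q.v α| ≤ 1 :=
      abs_le.2 ⟨by linarith [hu α, hv α, huv α], by linarith [hu α, hv α, huv α]⟩
    refine (le_abs_self _).trans ?_
    rw [abs_mul]
    exact mul_le_of_le_one_left (abs_nonneg _) h1
  · exact ⟨_, ofSeq_mem_dualFeasOne f momentFeasible_zero (by simp), by
      rw [dualObj_ofSeq]; simp⟩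
  · intro c hc z hz hneg
    set w : nzIdx n f.totalDegree → ℝ := fun α => z α.1 with hw
    -- `F` is the centre of the ball {φ ≤ c}, so w ≠ 0 and its norm can be divided out.
    have hwF : ∑ α, w α * F α < 0 := hneg F (by simpa using hc)
    have hpos : 0 < ‖w‖ := (norm_nonneg w).lt_of_ne' fun h0 =>
      hwF.ne (sum_mul_eq_zero_of_norm_eq_zero h0 F)
    have hle : ‖c • w‖ ≤ -∑ α, w α * F α := by
      refine (pi_norm_le_iff_of_nonneg (by linarith)).2 fun β => ?_
      -- A vertex of the ℓ¹ ball of radius c about `F`. Letting β vary gives c times the sup norm of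
      -- w, the dual norm.
      have h1 := hneg (F + Pi.single β (c * SignType.sign (w β))) (by
        rw [Finset.sum_eq_single β]
        · have : |(SignType.sign (w β) : ℝ)| ≤ 1 := by
            rcases lt_trichotomy (w β) 0 with h | h | h <;> simp [h]
          simpa [abs_mul, abs_of_nonneg hc] using mul_le_of_le_one_right hc this
        · intro α _ hα
          simp [hα]
        · simp)
      have h2 : ∑ α, w α * (F + Pi.single β (c * SignType.sign (w β)) : nzIdx n f.totalDegree → ℝ) α =
          ∑ α, w α * F α + c * |w β| := by
        simp only [Pi.add_apply, mul_add, Finset.sum_add_distrib]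
        congr 1
        rw [Finset.sum_eq_single β]
        · rw [Pi.single_eq_same, ← self_mul_sign (w β)]
          ring
        · intro α _ hα
          simp [hα]
        · simp
      rw [h2] at h1
      rw [Pi.smul_apply, norm_smul, Real.norm_of_nonneg hc, Real.norm_eq_abs]
      linarith
    rw [norm_smul, Real.norm_of_nonneg hc] at hle
    refine ⟨_, ofSeq_mem_dualFeasOne f (hz.smul (inv_nonneg.2 hpos.le)) fun α => ?_,
      le_dualObj_ofSeq_inv_smul f hpos hle⟩
    rw [Pi.smul_apply, smul_eq_mul, abs_mul, abs_of_nonneg (inv_nonneg.2 hpos.le),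
      inv_mul_le_one₀ hpos]
    exact norm_le_pi_norm w α

theorem top_program (hK : (interior (feasibleSet g)).Nonempty) :
    NoDualityGap (primalFeasTop f g d) (primalObjTop g d) (dualFeasTop f g d) (dualObj f) ∧
      HasOptimalSolution (primalFeasTop f g d) (primalObjTop g d) := by
  set F := coeffVec f.totalDegree f with hF
  refine noDualityGap_and_hasOptimalSolution (d := d) (φ := fun a => ‖F - a‖) hK
    (by fun_prop) (convexOn_norm_sub F) (fun c => isBounded_of_abs_sub_le F c
      fun a ha i => (norm_le_pi_norm (F - a) i).trans ha) ?_ ?_ ?_ ?_ ?_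
  · rintro ⟨l, c⟩ ⟨hl, h1, h2, hc⟩
    refine ⟨c, hc, (pi_norm_le_iff_of_nonneg hl).2 fun α => abs_le.2 ⟨?_, ?_⟩⟩
    · have := h2 α
      simp only [hF, coeffVec, Pi.sub_apply] at this ⊢
      linarith
    · have := h1 α
      simp only [hF, coeffVec, Pi.sub_apply] at this ⊢
      linarith
  · intro c hc
    have hle : ∀ α, |F α - coeffVec _ c.ft α| ≤ ‖F - coeffVec _ c.ft‖ :=
      norm_le_pi_norm (F - coeffVec _ c.ft)
    refine ⟨(‖F - coeffVec _ c.ft‖, c),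
      ⟨norm_nonneg _, fun α => ?_, fun α => ?_, hc⟩, rfl⟩
    · have h1 : f.coeff α.1 - c.ft.coeff α.1 ≤ _ := (le_abs_self _).trans (hle α)
      dsimp only
      linarith
    · have h1 : _ ≤ f.coeff α.1 - c.ft.coeff α.1 := (abs_le.1 (hle α)).1
      dsimp only
      linarith
  · rintro q ⟨hu, hv, huv, hz, hM⟩
    refine ⟨q.z, hM, fun a ha => (dualObj_le f hz ha).trans ?_⟩
    have h1 : ∀ α, (q.u α - q.v α) * (F α - a α) ≤ (q.u α + q.v α) * ‖F - a‖ := fun α => by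
      refine (le_abs_self _).trans ?_
      rw [abs_mul]
      refine mul_le_mul (abs_le.2 ⟨?_, ?_⟩) (norm_le_pi_norm (F - a) α) (abs_nonneg _) ?_ <;>
        linarith [hu α, hv α]
    refine (Finset.sum_le_sum fun α _ => h1 α).trans ?_
    rw [← Finset.sum_mul]
    exact mul_le_of_le_one_left (norm_nonneg _) huv
  · exact ⟨_, ofSeq_mem_dualFeasTop f momentFeasible_zero (by simp), by
      rw [dualObj_ofSeq]; simp⟩
  · intro c hc z hz hneg
    set w : nzIdx n f.totalDegree → ℝ := fun α => z α.1 with hw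
    have hwF : ∑ α, w α * F α < 0 := hneg F (by simpa using hc)
    have hpos : 0 < ∑ α, |w α| := by
      refine (Finset.sum_nonneg fun α _ => abs_nonneg (w α)).lt_of_ne' fun h0 => hwF.ne ?_
      have h1 := (Finset.sum_eq_zero_iff_of_nonneg fun α _ => abs_nonneg (w α)).1 h0
      exact Finset.sum_eq_zero fun α hα => by rw [abs_eq_zero.1 (h1 α hα), zero_mul]
    have hle : c * ∑ α, |w α| ≤ -∑ α, w α * F α := by
      -- The point of the sup-norm ball of radius c about `F` where w is largest; it gives c times
      -- the ℓ¹ norm of w.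
      have h1 := hneg (fun α => F α + c * SignType.sign (w α)) (by
        refine (pi_norm_le_iff_of_nonneg hc).2 fun β => ?_
        have : |(SignType.sign (w β) : ℝ)| ≤ 1 := by
          rcases lt_trichotomy (w β) 0 with h | h | h <;> simp [h]
        simpa [abs_mul, abs_of_nonneg hc] using mul_le_of_le_one_right hc this)
      have h2 : ∑ α, w α * (F α + c * SignType.sign (w α)) =
          ∑ α, w α * F α + c * ∑ α, |w α| := by
        rw [Finset.mul_sum, ← Finset.sum_add_distrib]
        refine Finset.sum_congr rfl fun α _ => ?_
        rw [← self_mul_sign (w α)]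
        ring
      rw [h2] at h1
      linarith
    refine ⟨_, ofSeq_mem_dualFeasTop f (hz.smul (inv_nonneg.2 hpos.le)) ?_,
      le_dualObj_ofSeq_inv_smul f hpos hle⟩
    simp only [Pi.smul_apply, smul_eq_mul, abs_mul, abs_of_nonneg (inv_nonneg.2 hpos.le)]
    rw [← Finset.mul_sum, inv_mul_le_one₀ hpos]

end Linear

/-! ### The program for `k = 2` -/

section Quadratic

variable (f : MvPolynomial (Fin n) ℝ)

theorem quadraticForm_fin_two (M : Matrix (Fin 2) (Fin 2) ℝ) (x y : ℝ) :
    star ![x, y] ⬝ᵥ (M *ᵥ ![x, y]) = M 0 0 * x ^ 2 + (M 0 1 + M 1 0) * x * y + M 1 1 * y ^ 2 := by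
  simp [dotProduct, mulVec, Fin.sum_univ_two]
  ring

theorem posSemidef_fin_two_iff (l r : ℝ) :
    (!![l, r; r, 1] : Matrix (Fin 2) (Fin 2) ℝ).PosSemidef ↔ r ^ 2 ≤ l := by
  constructor
  · intro h
    have h1 := h.dotProduct_mulVec_nonneg ![1, -r]
    rw [quadraticForm_fin_two] at h1
    simp at h1
    linarith
  · intro h
    refine PosSemidef.of_dotProduct_mulVec_nonneg ?_ fun x => ?_
    · ext i j
      fin_cases i <;> fin_cases j <;> rfl
    · obtain ⟨a, b, rfl⟩ : ∃ a b, x = ![a, b] := ⟨x 0, x 1, by ext i; fin_cases i <;> rfl⟩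
      rw [quadraticForm_fin_two]
      simp
      nlinarith [sq_nonneg (r * a + b), mul_nonneg (sub_nonneg.2 h) (sq_nonneg a)]

/-- The dual point for `k = 2` with rank-one matrices obtained from a moment sequence `z`. -/
noncomputable def DualVarsTwo.ofSeq (z : (Fin n →₀ ℕ) → ℝ) : DualVarsTwo f where
  -- The constraint forces the off-diagonal entry −z_α/2; with upper-left entry 1, the lower-right
  -- entry z_α²/4 is the least that semidefiniteness allows.
  Δ α := vecMulVec ![1, -z α.1 / 2] (star ![1, -z α.1 / 2])
  z := z

theorem ofSeq_mem_dualFeasTwo {z : (Fin n →₀ ℕ) → ℝ} (hz : MomentFeasible g d z) :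
    DualVarsTwo.ofSeq f z ∈ dualFeasTwo f g d := by
  refine ⟨fun α => ?_, fun α => ?_, hz, fun α => posSemidef_vecMulVec_self_star _⟩
  · rw [DualVarsTwo.ofSeq, matInner_vecMulVec, quadraticForm_fin_two]
    simp
  · rw [DualVarsTwo.ofSeq, matInner_vecMulVec, quadraticForm_fin_two]
    simp
    ring

theorem dualObjTwo_ofSeq (z : (Fin n →₀ ℕ) → ℝ) :
    dualObjTwo f (DualVarsTwo.ofSeq f z) =
      -(∑ α, z α.1 * coeffVec f.totalDegree f α) -
        (∑ α : nzIdx n f.totalDegree, z α.1 ^ 2) / 4 := by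
  rw [dualObjTwo, ← Finset.sum_neg_distrib, Finset.sum_div, ← Finset.sum_sub_distrib]
  refine Finset.sum_congr rfl fun α _ => ?_
  rw [DualVarsTwo.ofSeq, matInner_vecMulVec, quadraticForm_fin_two, coeffVec]
  simp
  ring

theorem two_program (hK : (interior (feasibleSet g)).Nonempty) :
    NoDualityGap (primalFeasTwo f g d) (primalObj f g d) (dualFeasTwo f g d) (dualObjTwo f) ∧
      HasOptimalSolution (primalFeasTwo f g d) (primalObj f g d) := by
  set F := coeffVec f.totalDegree f with hF
  refine noDualityGap_and_hasOptimalSolution (d := d) (φ := fun a => ∑ α, (F α - a α) ^ 2) hK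
    (by fun_prop) (convexOn_sum_sq_sub F) (fun c => isBounded_of_abs_sub_le F (c + 1)
      fun a ha i => ?_) ?_ ?_ ?_ ?_ ?_
  · have h1 : (F i - a i) ^ 2 ≤ c := le_trans
      (Finset.single_le_sum (f := fun α => (F α - a α) ^ 2) (fun α _ => sq_nonneg _)
        (Finset.mem_univ i)) ha
    rw [← sq_abs] at h1
    nlinarith [sq_nonneg (|F i - a i| - 1), abs_nonneg (F i - a i)]
  · rintro ⟨l, c⟩ ⟨-, h1, hc⟩
    refine ⟨c, hc, Finset.sum_le_sum fun α _ => ?_⟩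
    have h2 := (posSemidef_fin_two_iff _ _).1 (h1 α)
    refine le_trans (le_of_eq ?_) h2
    simp only [hF, coeffVec]
    ring
  · intro c hc
    refine ⟨(fun α => (F α - coeffVec _ c.ft α) ^ 2, c),
      ⟨fun α => sq_nonneg _, fun α => (posSemidef_fin_two_iff _ _).2 (le_of_eq ?_), hc⟩, rfl⟩
    simp only [hF, coeffVec]
    ring
  · rintro q ⟨hA, hz, hM, hpsd⟩
    refine ⟨q.z, hM, fun a ha => ?_⟩
    have h1 : ∀ α, matInner (q.Δ α) !![0, f.coeff α.1; f.coeff α.1, -1] ≤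
        (F α - a α) ^ 2 - q.z α.1 * a α := fun α => by
      -- With r = F_α − a_α this reads Δ₁₁ ≥ 2 Δ₀₁ r − Δ₀₀ r². Hence the objective term is at most
      -- Δ₀₀ r² + 2 Δ₀₁ a_α, where Δ₀₀ ≤ 1 and 2 Δ₀₁ = −z_α.
      have h2 := (hpsd α).dotProduct_mulVec_nonneg ![F α - a α, -1]
      rw [quadraticForm_fin_two] at h2
      have h3 := hA α
      have h4 := hz α
      simp only [matInner, Fin.sum_univ_two, of_apply, cons_val', cons_val_zero, cons_val_one,
        cons_val_fin_one, mul_zero, mul_one, zero_add, add_zero] at h2 h3 h4 ⊢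
      change _ * F α + (_ * F α + _) ≤ _
      have h5 := congrArg (· * a α) h4
      simp only [zero_mul] at h5
      linarith [mul_nonneg (sub_nonneg.2 h3) (sq_nonneg (F α - a α))]
    refine (Finset.sum_le_sum fun α _ => h1 α).trans ?_
    rw [Finset.sum_sub_distrib]
    linarith
  · exact ⟨_, ofSeq_mem_dualFeasTwo f momentFeasible_zero, by
      rw [dualObjTwo_ofSeq]; simp⟩
  · intro c hc z hz hneg
    set w : nzIdx n f.totalDegree → ℝ := fun α => z α.1 with hw
    have hwF : ∑ α, w α * F α < 0 := hneg F (by simpa using hc)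
    have hWpos : 0 < ∑ α, w α ^ 2 := by
      refine (Finset.sum_nonneg fun α _ => sq_nonneg (w α)).lt_of_ne' fun h0 => hwF.ne ?_
      have h1 := (Finset.sum_eq_zero_iff_of_nonneg fun α _ => sq_nonneg (w α)).1 h0
      exact Finset.sum_eq_zero fun α hα => by rw [pow_eq_zero_iff two_ne_zero |>.1 (h1 α hα),
        zero_mul]
    set W := ∑ α, w α ^ 2 with hW
    have hs : 0 ≤ √(c / W) := Real.sqrt_nonneg _
    have hsW : √(c / W) ^ 2 * W = c := by
      rw [Real.sq_sqrt (div_nonneg hc hWpos.le), div_mul_cancel₀ _ hWpos.ne']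
    -- The point of the Euclidean ball of squared radius c about `F` furthest in the direction w.
    have h1 := hneg (fun α => F α + √(c / W) * w α) (by
      refine le_of_eq (Eq.trans ?_ hsW)
      rw [hW, Finset.mul_sum]
      exact Finset.sum_congr rfl fun α _ => by ring)
    have h2 : ∑ α, w α * (F α + √(c / W) * w α) = ∑ α, w α * F α + √(c / W) * W := by
      rw [hW, Finset.mul_sum, ← Finset.sum_add_distrib]
      exact Finset.sum_congr rfl fun α _ => by ring
    rw [h2] at h1
    -- With s = √(c / W), scaling z by 2s gives the value −2s⟨w, F⟩ − s²W. Since ⟨w, F⟩ < −sW and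
    -- s²W = c, this is at least 2c − c = c.
    refine ⟨_, ofSeq_mem_dualFeasTwo f (hz.smul (mul_nonneg zero_le_two hs)), ?_⟩
    have h3 : dualObjTwo f (DualVarsTwo.ofSeq f ((2 * √(c / W)) • z)) =
        -(2 * √(c / W) * ∑ α, w α * F α) - √(c / W) ^ 2 * W := by
      rw [dualObjTwo_ofSeq, hW, Finset.mul_sum, Finset.mul_sum, Finset.sum_div]
      refine congrArg₂ _ (congrArg _ ?_) ?_
      · exact Finset.sum_congr rfl fun α _ => by simp only [Pi.smul_apply, smul_eq_mul, hw]; ring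
      · exact Finset.sum_congr rfl fun α _ => by simp only [Pi.smul_apply, smul_eq_mul, hw]; ring
    rw [h3, hsW]
    have h4 : √(c / W) * (∑ α, w α * F α + √(c / W) * W) ≤ 0 :=
      mul_nonpos_of_nonneg_of_nonpos hs h1.le
    linarith

end Quadratic

end Programs

end InvPolyOpt

open InvPolyOpt in
theorem lemma3p2 (n m : ℕ) (f : MvPolynomial (Fin n) ℝ) (g : Fin m → MvPolynomial (Fin n) ℝ)
    (d : ℕ) (hK : (interior (feasibleSet g)).Nonempty) :
    (NoDualityGap (primalFeasOne f g d) (primalObj f g d) (dualFeasOne f g d) (dualObj f) ∧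
      NoDualityGap (primalFeasTop f g d) (primalObjTop g d) (dualFeasTop f g d) (dualObj f) ∧
      NoDualityGap (primalFeasTwo f g d) (primalObj f g d) (dualFeasTwo f g d) (dualObjTwo f)) ∧
    (HasOptimalSolution (primalFeasOne f g d) (primalObj f g d) ∧
      HasOptimalSolution (primalFeasTop f g d) (primalObjTop g d) ∧
      HasOptimalSolution (primalFeasTwo f g d) (primalObj f g d)) :=
  ⟨⟨(one_program f hK).1, (top_program f hK).1, (two_program f hK).1⟩,
    (one_program f hK).2, (top_program f hK).2, (two_program f hK).2⟩
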